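/- Let $a,b\in\mathbb{R}$ with $4a\neq b^2$, and let $M(a,b)$ be the Bianchi--Cartan--Vranceanu space, i.e. the set $\{(x,y,z)\in\mathbb{R}^3:\lambda=1+a(x^2+y^2)>0\}$ with the Riemannian metric $$\langle\,,\rangle=\frac{dx^2+dy^2}{\lambda^2}+\Big(dz+\frac b2\,\frac{y\,dx-x\,dy}{\lambda}\Big)^2 ,$$ with Levi-Civita connection $\nabla$ and curvature tensor $R(X,Y)Z=\nabla_X\nabla_YZ-\nabla_Y\nabla_XZ-\nabla_{[X,Y]}Z$. Put $E_3=\partial/\partial z$, a Killing vector field with flow $\psi_t(x,y,z)=(x,y,z+t)$. Let $\gamma:I\to M(a,b)$ be a smooth arc-length parametrized curve on a nonempty open interval $I\subset\mathbb{R}$, with $T=\gamma'$, which is triharmonic, i.e. $$\nabla_T^5T+R(\nabla_T^3T,T)T-R(\nabla_T^2T,\nabla_TT)T=0 ,$$ and a Frenet helix, i.e. there are a smooth orthonormal frame $\{T,N,B\}$ along $\gamma$ and constants $\kappa_0>0$ (curvature) and $\tau_0$ (torsion) with $$\nabla_TT=\kappa_0N,\qquad \nabla_TN=-\kappa_0T+\tau_0B,\qquad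 \nabla_TB=-\tau_0N .$$ If $\tau_0\neq0$, then $N_3=\langle N,E_3\rangle=0$ along $\gamma$. Moreover, $\gamma$ is a geodesic of a Hopf cylinder: there are a nonempty open interval $J$ and a smooth arc-length parametrized curve $\alpha:J\to M(a,b)$ orthogonal to $E_3$ such that $\gamma(s)=\mathbf{x}(c(s))$ for all $s\in I$, where $\mathbf{x}(u,t)=\psi_t(\alpha(u))$ on $J\times\mathbb{R}$ and $c:I\to J\times\mathbb{R}$ is a geodesic of the metric induced on $J\times\mathbb{R}$ by the immersion $\mathbf{x}$. -/

import Mathlib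

open scoped ContDiff Matrix

noncomputable section

/-! Riemannian geometry in a global chart of dimension `n`.
A metric is given by its Gram matrix `g p` at each point `p`. -/

namespace Chart

variable {n m : ℕ}

/-- The inner product `⟨v, w⟩` of two tangent vectors at `p`. -/
def ip (g : (Fin n → ℝ) → Matrix (Fin n) (Fin n) ℝ) (p v w : Fin n → ℝ) : ℝ :=
  ∑ i, ∑ j, g p i j * v i * w j

/-- The partial derivative `∂ᵢ f` at `p`. -/
def pd {F : Type*} [NormedAddCommGroup F] [NormedSpace ℝ F]
    (i : Fin n) (f : (Fin n → ℝ) → F) (p : Fin n → ℝ) : F :=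
  fderiv ℝ f p (Pi.single i 1)

/-- The Christoffel symbol `Γᵏᵢⱼ` of the Levi-Civita connection of `g`. -/
def christoffel (g : (Fin n → ℝ) → Matrix (Fin n) (Fin n) ℝ) (k i j : Fin n)
    (p : Fin n → ℝ) : ℝ :=
  (1 / 2) * ∑ l, (g p)⁻¹ k l *
    (pd i (fun q => g q j l) p + pd j (fun q => g q i l) p - pd l (fun q => g q i j) p)

/-- The `l`-th coordinate of `R(∂ᵢ, ∂ⱼ) ∂ₖ`, for the sign convention
`R(X, Y) Z = ∇_X ∇_Y Z - ∇_Y ∇_X Z - ∇_[X,Y] Z`. -/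
def riemannCoord (g : (Fin n → ℝ) → Matrix (Fin n) (Fin n) ℝ) (l i j k : Fin n)
    (p : Fin n → ℝ) : ℝ :=
  pd i (christoffel g l j k) p - pd j (christoffel g l i k) p +
    ∑ r, (christoffel g l i r p * christoffel g r j k p -
      christoffel g l j r p * christoffel g r i k p)

/-- The Riemann curvature `R(X, Y) Z` of tangent vectors at `p`. -/
def riemann (g : (Fin n → ℝ) → Matrix (Fin n) (Fin n) ℝ) (p X Y Z : Fin n → ℝ) :
    Fin n → ℝ :=
  fun l => ∑ i, ∑ j, ∑ k, riemannCoord g l i j k p * X i * Y j * Z k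

/-- The covariant derivative `∇_{γ'} V` of a vector field `V` along the curve `γ`. -/
def covDeriv (g : (Fin n → ℝ) → Matrix (Fin n) (Fin n) ℝ) (γ V : ℝ → Fin n → ℝ) :
    ℝ → Fin n → ℝ :=
  fun s k => deriv V s k + ∑ i, ∑ j, christoffel g k i j (γ s) * deriv γ s i * V s j

/-- `∇_T^r T` along `γ`, where `T = γ'`. -/
def iterCov (g : (Fin n → ℝ) → Matrix (Fin n) (Fin n) ℝ) (γ : ℝ → Fin n → ℝ) (r : ℕ) :
    ℝ → Fin n → ℝ :=
  (covDeriv g γ)^[r] (deriv γ)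

/-- `γ` is a geodesic on `I`: it is smooth and `∇_{γ'} γ' = 0`. -/
def IsGeodesicOn (g : (Fin n → ℝ) → Matrix (Fin n) (Fin n) ℝ) (I : Set ℝ)
    (γ : ℝ → Fin n → ℝ) : Prop :=
  ContDiffOn ℝ ∞ γ I ∧ ∀ s ∈ I, covDeriv g γ (deriv γ) s = 0

/-- The arc-length parametrized curve `γ` is triharmonic on `I`:
`∇_T^5 T + R(∇_T^3 T, T) T - R(∇_T^2 T, ∇_T T) T = 0`. -/
def IsTriharmonicOn (g : (Fin n → ℝ) → Matrix (Fin n) (Fin n) ℝ) (I : Set ℝ)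
    (γ : ℝ → Fin n → ℝ) : Prop :=
  (∀ s ∈ I, ip g (γ s) (deriv γ s) (deriv γ s) = 1) ∧
  ∀ s ∈ I, iterCov g γ 5 s
      + riemann g (γ s) (iterCov g γ 3 s) (deriv γ s) (deriv γ s)
      - riemann g (γ s) (iterCov g γ 2 s) (iterCov g γ 1 s) (deriv γ s) = 0

/-- In dimension three, `{γ', N, B}` is a Frenet frame of the non-geodesic arc-length
parametrized curve `γ` on `I`, with curvature `κ > 0` and torsion `τ`. -/
structure IsFrenetFrameOn (g : (Fin 3 → ℝ) → Matrix (Fin 3) (Fin 3) ℝ) (I : Set ℝ)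
    (γ N B : ℝ → Fin 3 → ℝ) (κ τ : ℝ → ℝ) : Prop where
  smooth_curve : ContDiffOn ℝ ∞ γ I
  smooth_N : ContDiffOn ℝ ∞ N I
  smooth_B : ContDiffOn ℝ ∞ B I
  TT : ∀ s ∈ I, ip g (γ s) (deriv γ s) (deriv γ s) = 1
  NN : ∀ s ∈ I, ip g (γ s) (N s) (N s) = 1
  BB : ∀ s ∈ I, ip g (γ s) (B s) (B s) = 1
  TN : ∀ s ∈ I, ip g (γ s) (deriv γ s) (N s) = 0
  TB : ∀ s ∈ I, ip g (γ s) (deriv γ s) (B s) = 0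
  NB : ∀ s ∈ I, ip g (γ s) (N s) (B s) = 0
  curvature_pos : ∀ s ∈ I, 0 < κ s
  frenet_T : ∀ s ∈ I, covDeriv g γ (deriv γ) s = κ s • N s
  frenet_N : ∀ s ∈ I, covDeriv g γ N s = -κ s • deriv γ s + τ s • B s
  frenet_B : ∀ s ∈ I, covDeriv g γ B s = -τ s • N s

/-- `γ` is a Frenet helix on `I` with Frenet frame `{γ', N, B}`:
its curvature and its torsion are the constants `κ₀` and `τ₀`. -/
def IsFrenetHelixOn (g : (Fin 3 → ℝ) → Matrix (Fin 3) (Fin 3) ℝ) (I : Set ℝ)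
    (γ N B : ℝ → Fin 3 → ℝ) (κ₀ τ₀ : ℝ) : Prop :=
  IsFrenetFrameOn g I γ N B (fun _ => κ₀) (fun _ => τ₀)

/-- The metric induced by `g` on the parameter domain of `x`. -/
def inducedMetric (g : (Fin n → ℝ) → Matrix (Fin n) (Fin n) ℝ)
    (x : (Fin m → ℝ) → Fin n → ℝ) : (Fin m → ℝ) → Matrix (Fin m) (Fin m) ℝ :=
  fun p => Matrix.of fun i j => ip g (x p) (pd i x p) (pd j x p)

/-- `γ` is a geodesic of the surface parametrized by `x` on the domain `D`: it is
`x ∘ c` for a geodesic `c` of the induced metric in `D`. -/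
def IsGeodesicOfSurface (g : (Fin n → ℝ) → Matrix (Fin n) (Fin n) ℝ)
    (x : (Fin 2 → ℝ) → Fin n → ℝ) (D : Set (Fin 2 → ℝ)) (I : Set ℝ)
    (γ : ℝ → Fin n → ℝ) : Prop :=
  ∃ c : ℝ → Fin 2 → ℝ, (∀ s ∈ I, c s ∈ D) ∧ (∀ s ∈ I, γ s = x (c s)) ∧
    IsGeodesicOn (inducedMetric g x) I c

end Chart

/-! The Bianchi-Cartan-Vranceanu space `M(a,b)`, with coordinates
`(x, y, z) = (p 0, p 1, p 2)`. -/

namespace BCV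

/-- `λ_a = 1 + a (x² + y²)`. -/
def lam (a : ℝ) (p : Fin 3 → ℝ) : ℝ := 1 + a * (p 0 ^ 2 + p 1 ^ 2)

/-- The underlying set `{λ_a > 0}` of `M(a,b)`. -/
def space (a : ℝ) : Set (Fin 3 → ℝ) := {p | 0 < lam a p}

/-- The coefficients of the 1-form `dz + (b/2) (y dx - x dy) / λ_a`. -/
def omega (a b : ℝ) (p : Fin 3 → ℝ) : Fin 3 → ℝ :=
  ![b / 2 * (p 1 / lam a p), -(b / 2 * (p 0 / lam a p)), 1]

/-- The metric `(dx² + dy²) / λ_a² + (dz + (b/2) (y dx - x dy) / λ_a)²`. -/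
def metric (a b : ℝ) (p : Fin 3 → ℝ) : Matrix (Fin 3) (Fin 3) ℝ :=
  Matrix.diagonal ![1 / lam a p ^ 2, 1 / lam a p ^ 2, 0] +
    Matrix.vecMulVec (omega a b p) (omega a b p)

/-- The unit Killing vector field `E₃ = ∂/∂z`. -/
def E3 : Fin 3 → ℝ := Pi.single 2 1

/-- The one-parameter group `ψ_t` of isometries generated by `E₃`. -/
def flow (t : ℝ) (p : Fin 3 → ℝ) : Fin 3 → ℝ := p + t • E3

/-- `α` is an arc-length parametrized curve in `M(a,b)`, defined on the nonempty open
interval `J` and orthogonal to `E₃`: the profile curve of a Hopf cylinder. -/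
structure IsHopfProfile (a b : ℝ) (J : Set ℝ) (α : ℝ → Fin 3 → ℝ) : Prop where
  isOpen : IsOpen J
  ordConnected : J.OrdConnected
  nonempty : J.Nonempty
  smooth : ContDiffOn ℝ ∞ α J
  mem_space : ∀ u ∈ J, α u ∈ space a
  unit_speed : ∀ u ∈ J, Chart.ip (metric a b) (α u) (deriv α u) (deriv α u) = 1
  orthogonal : ∀ u ∈ J, Chart.ip (metric a b) (α u) (deriv α u) E3 = 0

/-- The Hopf cylinder `(u, t) ↦ ψ_t (α u)` over the profile curve `α`. -/
def hopfCylinder (α : ℝ → Fin 3 → ℝ) (q : Fin 2 → ℝ) : Fin 3 → ℝ := flow (q 1) (α (q 0))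

/-- The parameter domain `J × ℝ` of a Hopf cylinder. -/
def hopfDomain (J : Set ℝ) : Set (Fin 2 → ℝ) := {q | q 0 ∈ J}

end BCV

end

/-! Write V₃ = ⟨V, E₃⟩ and c = 4a - b². The covariant derivatives of T along a helix have constant
coefficients in T, N, B, so the triharmonic equation becomes algebraic once the curvature is
explicit. Its B-component says c N₃ ((2κ² + τ²) B₃ + κτ T₃) = 0. If N₃ ≠ 0 at a point, the last
factor vanishes nearby. Differentiating it with T₃' = κ N₃ and B₃' = -(τ - bD/2) N₃, where D = ±1 is
the orientation of the frame, gives one relation among the constants; the N-component gives a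
second, and together they force κ = 0 (`helix_constants_absurd`, `triharmonic_helix_N3`).

Hence N₃ = 0 and T₃ is a constant m. Here m² < 1: otherwise B₃ = 0, and N₃' = 0 gives m = 0. Sliding
the points of γ along the fibres cancels its vertical motion and yields a horizontal profile curve.
The Hopf cylinder over it is flat, and γ is a straight line in it
(`exists_hopfCylinder_of_constant_angle`). -/

noncomputable section

/-! ### Christoffel symbols and curvature of M(a,b). -/

namespace BCV

/-- A quadratic polynomial in `x / λ`, `y / λ` and `1 / λ`. -/
def quad (a : ℝ) (c : Fin 7 → ℝ) (p : Fin 3 → ℝ) : ℝ :=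
  let r := (lam a p)⁻¹
  c 0 + c 1 * (p 0 * r) + c 2 * (p 1 * r) + c 3 * ((p 0 * r) * (p 0 * r)) +
    c 4 * ((p 0 * r) * (p 1 * r)) + c 5 * ((p 1 * r) * (p 1 * r)) + c 6 * (r * r)

/-- The partial derivatives of `quad a c`. -/
def dquad (a : ℝ) (c : Fin 7 → ℝ) (p : Fin 3 → ℝ) : Fin 3 → ℝ :=
  let r := (lam a p)⁻¹
  let X := p 0 * r
  let Y := p 1 * r
  ![c 1 * (r - 2 * a * X * X) - c 2 * (2 * a * X * Y) + c 3 * (2 * X * (r - 2 * a * X * X))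
      + c 4 * (Y * (r - 4 * a * X * X)) - c 5 * (4 * a * X * Y * Y) - c 6 * (4 * a * X * r * r),
    c 2 * (r - 2 * a * Y * Y) - c 1 * (2 * a * X * Y) + c 5 * (2 * Y * (r - 2 * a * Y * Y))
      + c 4 * (X * (r - 4 * a * Y * Y)) - c 3 * (4 * a * X * X * Y) - c 6 * (4 * a * Y * r * r),
    0]

theorem hasFDerivAt_lam (a : ℝ) (p : Fin 3 → ℝ) :
    HasFDerivAt (lam a) ((2 * a * p 0) • ContinuousLinearMap.proj (R := ℝ) (φ := fun _ => ℝ) (0 : Fin 3)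
      + (2 * a * p 1) • ContinuousLinearMap.proj (R := ℝ) (φ := fun _ => ℝ) (1 : Fin 3)) p := by
  have h0 := hasFDerivAt_apply (𝕜 := ℝ) (F' := fun _ : Fin 3 => ℝ) 0 p
  have h1 := hasFDerivAt_apply (𝕜 := ℝ) (F' := fun _ : Fin 3 => ℝ) 1 p
  have := (((h0.pow 2).add (h1.pow 2)).const_mul a).const_add 1
  refine this.congr_fderiv ?_
  ext v
  simp
  ring

theorem isOpen_space (a : ℝ) : IsOpen (space a) := by
  unfold space lam
  exact isOpen_lt continuous_const (by fun_prop)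

theorem pd_eq {i : Fin 3} {f : (Fin 3 → ℝ) → ℝ} {f' : (Fin 3 → ℝ) →L[ℝ] ℝ} {p : Fin 3 → ℝ}
    (h : HasFDerivAt f f' p) : Chart.pd i f p = f' (Pi.single i 1) := by
  rw [Chart.pd, h.fderiv]

theorem pd_quad {a : ℝ} {p : Fin 3 → ℝ} (hp : p ∈ space a) (c : Fin 7 → ℝ) (i : Fin 3) :
    Chart.pd i (quad a c) p = dquad a c p i := by
  have h0 := hasFDerivAt_apply (𝕜 := ℝ) (F' := fun _ : Fin 3 => ℝ) 0 p
  have h1 := hasFDerivAt_apply (𝕜 := ℝ) (F' := fun _ : Fin 3 => ℝ) 1 p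
  have hr := (hasDerivAt_inv (ne_of_gt hp)).comp_hasFDerivAt p (hasFDerivAt_lam a p)
  have hX := h0.mul hr
  have hY := h1.mul hr
  have h : HasFDerivAt (quad a c) _ p :=
    ((((((hasFDerivAt_const (c 0) p).add (hX.const_mul (c 1))).add (hY.const_mul (c 2))).add
      ((hX.mul hX).const_mul (c 3))).add ((hX.mul hY).const_mul (c 4))).add
      ((hY.mul hY).const_mul (c 5))).add ((hr.mul hr).const_mul (c 6))
  refine (pd_eq h).trans ?_
  have hne : lam a p ≠ 0 := ne_of_gt hp
  fin_cases i <;> simp [dquad] <;> field_simp <;> ring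

/-- The coefficients of the metric as quadratic polynomials. -/
def metricCoeff (b : ℝ) : Fin 3 → Fin 3 → Fin 7 → ℝ :=
  ![![![0, 0, 0, 0, 0, b ^ 2 / 4, 1], ![0, 0, 0, 0, -b ^ 2 / 4, 0, 0], ![0, 0, b / 2, 0, 0, 0, 0]],
    ![![0, 0, 0, 0, -b ^ 2 / 4, 0, 0], ![0, 0, 0, b ^ 2 / 4, 0, 0, 1], ![0, -b / 2, 0, 0, 0, 0, 0]],
    ![![0, 0, b / 2, 0, 0, 0, 0], ![0, -b / 2, 0, 0, 0, 0, 0], ![1, 0, 0, 0, 0, 0, 0]]]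

theorem metric_eq_quad (a b : ℝ) (p : Fin 3 → ℝ) (i j : Fin 3) :
    metric a b p i j = quad a (metricCoeff b i j) p := by
  fin_cases i <;> fin_cases j <;>
    simp [metric, omega, quad, metricCoeff] <;> ring_nf <;> simp

/-- The coefficients of the Christoffel symbols as quadratic polynomials. -/
def christoffelCoeff (a b : ℝ) : Fin 3 → Fin 3 → Fin 3 → Fin 7 → ℝ :=
  ![![![![0, -2 * a, 0, 0, 0, 0, 0], ![0, 0, b ^ 2 / 4 - 2 * a, 0, 0, 0, 0], 0],
      ![![0, 0, b ^ 2 / 4 - 2 * a, 0, 0, 0, 0], ![0, 2 * a - b ^ 2 / 2, 0, 0, 0, 0, 0],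
        ![b / 2, 0, 0, 0, 0, 0, 0]],
      ![0, ![b / 2, 0, 0, 0, 0, 0, 0], 0]],
    ![![![0, 0, 2 * a - b ^ 2 / 2, 0, 0, 0, 0], ![0, b ^ 2 / 4 - 2 * a, 0, 0, 0, 0, 0],
        ![-b / 2, 0, 0, 0, 0, 0, 0]],
      ![![0, b ^ 2 / 4 - 2 * a, 0, 0, 0, 0, 0], ![0, 0, -2 * a, 0, 0, 0, 0], 0],
      ![![-b / 2, 0, 0, 0, 0, 0, 0], 0, 0]],
    ![![![0, 0, 0, 0, a * b - b ^ 3 / 4, 0, 0],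
        ![0, 0, 0, b ^ 3 / 8 - a * b / 2, 0, a * b / 2 - b ^ 3 / 8, 0],
        ![0, -b ^ 2 / 4, 0, 0, 0, 0, 0]],
      ![![0, 0, 0, b ^ 3 / 8 - a * b / 2, 0, a * b / 2 - b ^ 3 / 8, 0],
        ![0, 0, 0, 0, b ^ 3 / 4 - a * b, 0, 0], ![0, 0, -b ^ 2 / 4, 0, 0, 0, 0]],
      ![![0, -b ^ 2 / 4, 0, 0, 0, 0, 0], ![0, 0, -b ^ 2 / 4, 0, 0, 0, 0], 0]]]

/-- The inverse of the Gram matrix of the metric. -/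
def metricInv (a b : ℝ) (p : Fin 3 → ℝ) : Matrix (Fin 3) (Fin 3) ℝ :=
  !![lam a p ^ 2, 0, -(b / 2 * p 1 * lam a p); 0, lam a p ^ 2, b / 2 * p 0 * lam a p;
    -(b / 2 * p 1 * lam a p), b / 2 * p 0 * lam a p, 1 + b ^ 2 / 4 * (p 0 ^ 2 + p 1 ^ 2)]

theorem metric_inv {a b : ℝ} {p : Fin 3 → ℝ} (hp : p ∈ space a) :
    (metric a b p)⁻¹ = metricInv a b p := by
  have hne : lam a p ≠ 0 := ne_of_gt hp
  apply Matrix.inv_eq_right_inv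
  ext i j
  rw [Matrix.mul_apply, Fin.sum_univ_three]
  simp only [metric_eq_quad]
  fin_cases i <;> fin_cases j <;> simp [quad, metricCoeff, metricInv] <;> field_simp <;> ring

theorem christoffel_eq_quad {a b : ℝ} {p : Fin 3 → ℝ} (hp : p ∈ space a) (k i j : Fin 3) :
    Chart.christoffel (metric a b) k i j p = quad a (christoffelCoeff a b k i j) p := by
  have hne : lam a p ≠ 0 := ne_of_gt hp
  -- λ stays an atom while denominators are cleared, and is expanded only for the final polynomial
  -- identity.
  have hL : lam a p = 1 + a * (p 0 ^ 2 + p 1 ^ 2) := rfl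
  unfold Chart.christoffel
  simp only [metric_eq_quad, pd_quad hp, metric_inv hp, Fin.sum_univ_three]
  fin_cases k <;> fin_cases i <;> fin_cases j <;>
    simp [dquad, quad, metricCoeff, metricInv, christoffelCoeff] <;> field_simp <;>
    (try simp only [hL]) <;> ring

end BCV

namespace BCV

/-- The closed form of the symbols is known only on `space a`; since this set is open, it may still
be differentiated there. -/
theorem pd_christoffel {a b : ℝ} {p : Fin 3 → ℝ} (hp : p ∈ space a) (l k i j : Fin 3) :
    Chart.pd l (Chart.christoffel (metric a b) k i j) p =
      dquad a (christoffelCoeff a b k i j) p l := by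
  rw [← pd_quad hp]
  unfold Chart.pd
  congr 1
  refine Filter.EventuallyEq.fderiv_eq ?_
  filter_upwards [(isOpen_space a).mem_nhds hp] with q hq
  exact christoffel_eq_quad hq k i j

-- A check of all 81 components. The first bracket is the constant-curvature tensor; 4a - b²
-- measures the deviation from it caused by the fibre direction.
set_option maxHeartbeats 4000000 in
theorem riemannCoord_eq {a b : ℝ} {p : Fin 3 → ℝ} (hp : p ∈ space a) (l i j k : Fin 3) :
    Chart.riemannCoord (metric a b) l i j k p =
      (4 * a - 3 * b ^ 2 / 4) *
          (metric a b p j k * (Pi.single i 1 : Fin 3 → ℝ) l - metric a b p i k * (Pi.single j 1 : Fin 3 → ℝ) l)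
        - (4 * a - b ^ 2) *
          (omega a b p j * omega a b p k * (Pi.single i 1 : Fin 3 → ℝ) l
            - omega a b p i * omega a b p k * (Pi.single j 1 : Fin 3 → ℝ) l
            + (metric a b p j k * omega a b p i - metric a b p i k * omega a b p j) * E3 l) := by
  have hne : lam a p ≠ 0 := ne_of_gt hp
  have hL : lam a p = 1 + a * (p 0 ^ 2 + p 1 ^ 2) := rfl
  unfold Chart.riemannCoord
  simp only [pd_christoffel hp, christoffel_eq_quad hp, metric_eq_quad, Fin.sum_univ_three]
  fin_cases l <;> fin_cases i <;> fin_cases j <;> fin_cases k <;>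
    simp [dquad, quad, metricCoeff, christoffelCoeff, omega, E3] <;> field_simp <;>
    (try simp only [hL]) <;> ring

theorem riemann_eq {a b : ℝ} {p : Fin 3 → ℝ} (hp : p ∈ space a) (X Y Z : Fin 3 → ℝ) :
    Chart.riemann (metric a b) p X Y Z =
      (4 * a - 3 * b ^ 2 / 4) •
          (Chart.ip (metric a b) p Y Z • X - Chart.ip (metric a b) p X Z • Y)
        - (4 * a - b ^ 2) •
          ((omega a b p ⬝ᵥ Y * omega a b p ⬝ᵥ Z) • X - (omega a b p ⬝ᵥ X * omega a b p ⬝ᵥ Z) • Y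
            + (Chart.ip (metric a b) p Y Z * omega a b p ⬝ᵥ X
              - Chart.ip (metric a b) p X Z * omega a b p ⬝ᵥ Y) • E3) := by
  ext l
  simp only [Chart.riemann, riemannCoord_eq hp, Chart.ip, dotProduct, Fin.sum_univ_three]
  fin_cases l <;> simp [E3] <;> ring

end BCV

/-! ### Orthonormal frame and derivatives of vertical components. -/

namespace BCV

/-- The coordinates of a tangent vector at `p` in an orthonormal frame `E₁, E₂, E₃`. -/
def frame (a b : ℝ) (p v : Fin 3 → ℝ) : Fin 3 → ℝ :=
  ![v 0 / lam a p, v 1 / lam a p, omega a b p ⬝ᵥ v]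

theorem ip_eq_frame (a b : ℝ) (p v w : Fin 3 → ℝ) :
    Chart.ip (metric a b) p v w = frame a b p v ⬝ᵥ frame a b p w := by
  simp [Chart.ip, metric, frame, dotProduct, Fin.sum_univ_three, omega]
  ring

theorem frame_E3 (a b : ℝ) (p : Fin 3 → ℝ) : frame a b p E3 = E3 := by
  ext i
  fin_cases i <;> simp [frame, E3, omega]

theorem ip_E3 (a b : ℝ) (p v : Fin 3 → ℝ) :
    Chart.ip (metric a b) p v E3 = omega a b p ⬝ᵥ v := by
  rw [ip_eq_frame, frame_E3]
  simp [frame, E3]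

/-- Metric compatibility leaves the extra term ⟨V, ∇_T E₃⟩, which equals -b/2 times the third frame
component of T × V. It is skew in T and V because E₃ is Killing. -/
theorem hasDerivAt_omega {a b : ℝ} {γ V : ℝ → Fin 3 → ℝ} {s : ℝ} (hp : γ s ∈ space a)
    (hγ : DifferentiableAt ℝ γ s) (hV : DifferentiableAt ℝ V s) :
    HasDerivAt (fun u => omega a b (γ u) ⬝ᵥ V u)
      (omega a b (γ s) ⬝ᵥ Chart.covDeriv (metric a b) γ V s
        - b / 2 * (frame a b (γ s) (deriv γ s) 0 * frame a b (γ s) (V s) 1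
          - frame a b (γ s) (deriv γ s) 1 * frame a b (γ s) (V s) 0)) s := by
  have hne : lam a (γ s) ≠ 0 := ne_of_gt hp
  have hL : lam a (γ s) = 1 + a * (γ s 0 ^ 2 + γ s 1 ^ 2) := rfl
  have g (i : Fin 3) : HasDerivAt (fun u => γ u i) (deriv γ s i) s :=
    hasDerivAt_pi.1 hγ.hasDerivAt i
  have v (i : Fin 3) : HasDerivAt (fun u => V u i) (deriv V s i) s :=
    hasDerivAt_pi.1 hV.hasDerivAt i
  have hl : HasDerivAt (fun u => lam a (γ u))
      (2 * a * (γ s 0 * deriv γ s 0 + γ s 1 * deriv γ s 1)) s := by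
    refine (((((g 0).fun_pow 2).fun_add ((g 1).fun_pow 2)).const_mul a).const_add 1).congr_deriv ?_
    simp
    ring
  have h := (((((g 1).fun_div hl hne).const_mul (b / 2)).fun_mul (v 0)).fun_add
    ((((g 0).fun_div hl hne).const_mul (b / 2)).fun_neg.fun_mul (v 1))).fun_add (v 2)
  have e : (fun u => omega a b (γ u) ⬝ᵥ V u) = fun u => b / 2 * (γ u 1 / lam a (γ u)) * V u 0 +
      -(b / 2 * (γ u 0 / lam a (γ u))) * V u 1 + V u 2 := by
    ext u
    simp [omega, dotProduct, Fin.sum_univ_three]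
  rw [e]
  refine h.congr_deriv ?_
  simp only [Chart.covDeriv, dotProduct, christoffel_eq_quad hp, Fin.sum_univ_three]
  simp [omega, frame, quad, christoffelCoeff]
  field_simp
  simp only [hL]
  ring

end BCV

/-- The rows of an orthogonal `3 × 3` matrix. -/
theorem orthonormal_triple {t n b : Fin 3 → ℝ} (htt : t ⬝ᵥ t = 1) (hnn : n ⬝ᵥ n = 1)
    (hbb : b ⬝ᵥ b = 1) (htn : t ⬝ᵥ n = 0) (htb : t ⬝ᵥ b = 0) (hnb : n ⬝ᵥ b = 0) :
    t 2 ^ 2 + n 2 ^ 2 + b 2 ^ 2 = 1 ∧ ∃ D : ℝ, D ^ 2 = 1 ∧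
      t 0 * n 1 - t 1 * n 0 = D * b 2 ∧ t 0 * b 1 - t 1 * b 0 = -D * n 2 := by
  set M : Matrix (Fin 3) (Fin 3) ℝ := Matrix.of ![t, n, b] with hM
  have h1 : M * Mᵀ = 1 := by
    ext i j
    rw [Matrix.mul_apply_eq_vecMul]
    change ![t, n, b] i ⬝ᵥ ![t, n, b] j = _
    rw [dotProduct_comm] at htn htb hnb
    have htn' := dotProduct_comm t n
    have htb' := dotProduct_comm t b
    have hnb' := dotProduct_comm n b
    fin_cases i <;> fin_cases j <;> simp [*]
  have h2 : Mᵀ * M = 1 := mul_eq_one_comm.1 h1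
  have hd : M.det ^ 2 = 1 := by
    have := congrArg Matrix.det h1
    rwa [Matrix.det_mul, Matrix.det_transpose, Matrix.det_one, ← sq] at this
  -- Entries of this identity are the cross products t × n = D b and t × b = -D n, with D = det M.
  have had : M.adjugate = M.det • Mᵀ := by
    calc M.adjugate = M.adjugate * (M * Mᵀ) := by rw [h1, mul_one]
      _ = M.det • Mᵀ := by rw [← mul_assoc, Matrix.adjugate_mul, Matrix.smul_mul, one_mul]
  refine ⟨?_, M.det, hd, ?_, ?_⟩
  · have := congrFun (congrFun h2 2) 2
    rw [Matrix.mul_apply, Fin.sum_univ_three] at this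
    simp [hM] at this
    linarith
  · have := congrFun (congrFun had 2) 2
    rw [Matrix.adjugate_fin_three] at this
    simpa [hM] using this
  · have := congrFun (congrFun had 2) 1
    rw [Matrix.adjugate_fin_three] at this
    simp only [hM] at this ⊢
    simp at this ⊢
    linarith

/-! ### Iterated covariant derivatives along a Frenet helix. -/

namespace Chart

variable {n : ℕ} {g : (Fin n → ℝ) → Matrix (Fin n) (Fin n) ℝ} {γ V W : ℝ → Fin n → ℝ} {s : ℝ}

theorem covDeriv_congr (h : V =ᶠ[nhds s] W) : covDeriv g γ V s = covDeriv g γ W s := by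
  ext k
  simp only [covDeriv, h.deriv_eq, h.eq_of_nhds]

theorem covDeriv_add (hV : DifferentiableAt ℝ V s) (hW : DifferentiableAt ℝ W s) :
    covDeriv g γ (fun u => V u + W u) s = covDeriv g γ V s + covDeriv g γ W s := by
  ext k
  simp only [covDeriv, deriv_fun_add hV hW, Pi.add_apply, mul_add, Finset.sum_add_distrib]
  ring

theorem covDeriv_const_smul (c : ℝ) (hV : DifferentiableAt ℝ V s) :
    covDeriv g γ (fun u => c • V u) s = c • covDeriv g γ V s := by
  ext k
  simp only [covDeriv, deriv_fun_const_smul c hV, Pi.smul_apply, smul_eq_mul, mul_add,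
    Finset.mul_sum]
  congr 1
  refine Finset.sum_congr rfl fun i _ => Finset.sum_congr rfl fun j _ => ?_
  ring

end Chart

namespace Chart.IsFrenetHelixOn

variable {g : (Fin 3 → ℝ) → Matrix (Fin 3) (Fin 3) ℝ} {I : Set ℝ} {γ N B : ℝ → Fin 3 → ℝ}
  {κ τ : ℝ} {s : ℝ}

theorem differentiableAt_curve (h : IsFrenetHelixOn g I γ N B κ τ) (hI : IsOpen I) (hs : s ∈ I) :
    DifferentiableAt ℝ γ s :=
  (h.smooth_curve.contDiffAt (hI.mem_nhds hs)).differentiableAt (by simp)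

theorem differentiableAt_deriv (h : IsFrenetHelixOn g I γ N B κ τ) (hI : IsOpen I) (hs : s ∈ I) :
    DifferentiableAt ℝ (deriv γ) s :=
  (((h.smooth_curve.deriv_of_isOpen (m := ∞) hI (by simp)).contDiffAt
    (hI.mem_nhds hs))).differentiableAt (by simp)

theorem differentiableAt_N (h : IsFrenetHelixOn g I γ N B κ τ) (hI : IsOpen I) (hs : s ∈ I) :
    DifferentiableAt ℝ N s :=
  (h.smooth_N.contDiffAt (hI.mem_nhds hs)).differentiableAt (by simp)

theorem differentiableAt_B (h : IsFrenetHelixOn g I γ N B κ τ) (hI : IsOpen I) (hs : s ∈ I) :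
    DifferentiableAt ℝ B s :=
  (h.smooth_B.contDiffAt (hI.mem_nhds hs)).differentiableAt (by simp)

/-- With constant κ and τ, the Frenet equations turn ∇_T into a fixed linear map on coefficient
triples, ready to be iterated. -/
theorem covDeriv_comb (h : IsFrenetHelixOn g I γ N B κ τ) (hI : IsOpen I) {V : ℝ → Fin 3 → ℝ}
    {x y z : ℝ} (hV : Set.EqOn V (fun s => x • deriv γ s + (y • N s + z • B s)) I) :
    Set.EqOn (covDeriv g γ V)
      (fun s => (-(κ * y)) • deriv γ s + ((κ * x - τ * z) • N s + (τ * y) • B s)) I := by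
  intro s hs
  have hT := h.differentiableAt_deriv hI hs
  have hN := h.differentiableAt_N hI hs
  have hB := h.differentiableAt_B hI hs
  rw [covDeriv_congr (hV.eventuallyEq_of_mem (hI.mem_nhds hs)),
    covDeriv_add (hT.fun_const_smul x) ((hN.fun_const_smul y).fun_add (hB.fun_const_smul z)),
    covDeriv_add (hN.fun_const_smul y) (hB.fun_const_smul z), covDeriv_const_smul x hT,
    covDeriv_const_smul y hN, covDeriv_const_smul z hB, h.frenet_T s hs, h.frenet_N s hs,
    h.frenet_B s hs]
  module

/-- The vector fields `∇_T^r T` of a Frenet helix that occur in the triharmonic equation. -/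
theorem iterCov_eq (h : IsFrenetHelixOn g I γ N B κ τ) (hI : IsOpen I) (hs : s ∈ I) :
    iterCov g γ 1 s = κ • N s ∧
    iterCov g γ 2 s = (-κ ^ 2) • deriv γ s + (κ * τ) • B s ∧
    iterCov g γ 3 s = (-(κ * (κ ^ 2 + τ ^ 2))) • N s ∧
    iterCov g γ 5 s = (κ * (κ ^ 2 + τ ^ 2) ^ 2) • N s := by
  have e0 : Set.EqOn (iterCov g γ 0) (fun s => (1 : ℝ) • deriv γ s +
      ((0 : ℝ) • N s + (0 : ℝ) • B s)) I := fun s _ => by simp [iterCov]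
  have step (r : ℕ) : iterCov g γ (r + 1) = covDeriv g γ (iterCov g γ r) :=
    Function.iterate_succ_apply' _ _ _
  have e1 := step 0 ▸ h.covDeriv_comb hI e0
  have e2 := step 1 ▸ h.covDeriv_comb hI e1
  have e3 := step 2 ▸ h.covDeriv_comb hI e2
  have e4 := step 3 ▸ h.covDeriv_comb hI e3
  have e5 := step 4 ▸ h.covDeriv_comb hI e4
  refine ⟨(e1 hs).trans ?_, (e2 hs).trans ?_, (e3 hs).trans ?_, (e5 hs).trans ?_⟩ <;>
    module

end Chart.IsFrenetHelixOn

/-! ### The triharmonic equation of a helix and the vanishing of N₃. -/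

namespace BCV

theorem ip_comm (a b : ℝ) (p v w : Fin 3 → ℝ) :
    Chart.ip (metric a b) p v w = Chart.ip (metric a b) p w v := by
  rw [ip_eq_frame, ip_eq_frame, dotProduct_comm]

end BCV

namespace Chart

variable {n : ℕ} (g : (Fin n → ℝ) → Matrix (Fin n) (Fin n) ℝ) (p v w u : Fin n → ℝ) (c : ℝ)

theorem ip_eq_dotProduct : ip g p v w = v ⬝ᵥ g p *ᵥ w := by
  simp only [ip, dotProduct, Matrix.mulVec, Finset.mul_sum]
  refine Finset.sum_congr rfl fun i _ => Finset.sum_congr rfl fun j _ => ?_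
  ring

theorem ip_add_left : ip g p (v + w) u = ip g p v u + ip g p w u := by
  simp [ip_eq_dotProduct, add_dotProduct]

theorem ip_sub_left : ip g p (v - w) u = ip g p v u - ip g p w u := by
  simp [ip_eq_dotProduct, sub_dotProduct]

theorem ip_smul_left : ip g p (c • v) u = c * ip g p v u := by
  simp [ip_eq_dotProduct]

theorem ip_zero_left : ip g p 0 u = 0 := by
  simp [ip_eq_dotProduct]

end Chart

namespace BCV

/-- Only inner products and vertical components remain, so the triharmonic equation can be projected
on the Frenet frame. -/
theorem ip_riemann {a b : ℝ} {p : Fin 3 → ℝ} (hp : p ∈ space a) (X Y Z W : Fin 3 → ℝ) :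
    Chart.ip (metric a b) p (Chart.riemann (metric a b) p X Y Z) W =
      (4 * a - 3 * b ^ 2 / 4) *
          (Chart.ip (metric a b) p Y Z * Chart.ip (metric a b) p X W
            - Chart.ip (metric a b) p X Z * Chart.ip (metric a b) p Y W)
        - (4 * a - b ^ 2) *
          (Chart.ip (metric a b) p Y E3 * Chart.ip (metric a b) p Z E3 * Chart.ip (metric a b) p X W
            - Chart.ip (metric a b) p X E3 * Chart.ip (metric a b) p Z E3
              * Chart.ip (metric a b) p Y W
            + (Chart.ip (metric a b) p Y Z * Chart.ip (metric a b) p X E3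
              - Chart.ip (metric a b) p X Z * Chart.ip (metric a b) p Y E3)
              * Chart.ip (metric a b) p W E3) := by
  rw [riemann_eq hp, ip_comm a b p W E3]
  simp only [Chart.ip_add_left, Chart.ip_sub_left, Chart.ip_smul_left, ip_E3]

section Helix

variable {a b : ℝ} {I : Set ℝ} {γ N B : ℝ → Fin 3 → ℝ} {κ τ : ℝ} {s : ℝ}

theorem hasDerivAt_ip_E3 {V : ℝ → Fin 3 → ℝ} (hp : γ s ∈ space a)
    (hγ : DifferentiableAt ℝ γ s) (hV : DifferentiableAt ℝ V s) :
    HasDerivAt (fun u => Chart.ip (metric a b) (γ u) (V u) E3)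
      (Chart.ip (metric a b) (γ s) (Chart.covDeriv (metric a b) γ V s) E3
        - b / 2 * (frame a b (γ s) (deriv γ s) 0 * frame a b (γ s) (V s) 1
          - frame a b (γ s) (deriv γ s) 1 * frame a b (γ s) (V s) 0)) s := by
  simp only [ip_E3]
  exact hasDerivAt_omega hp hγ hV

/-- The skew correction term vanishes for V = T. -/
theorem hasDerivAt_T3 (h : Chart.IsFrenetHelixOn (metric a b) I γ N B κ τ) (hI : IsOpen I)
    (hs : s ∈ I) (hp : γ s ∈ space a) :
    HasDerivAt (fun u => Chart.ip (metric a b) (γ u) (deriv γ u) E3)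
      (κ * Chart.ip (metric a b) (γ s) (N s) E3) s := by
  refine (hasDerivAt_ip_E3 hp (h.differentiableAt_curve hI hs)
    (h.differentiableAt_deriv hI hs)).congr_deriv ?_
  rw [h.frenet_T s hs, Chart.ip_smul_left]
  ring

/-- The sign D is chosen at the single point s; its constancy along the curve is never needed. -/
theorem hasDerivAt_N3_B3 (h : Chart.IsFrenetHelixOn (metric a b) I γ N B κ τ) (hI : IsOpen I)
    (hs : s ∈ I) (hp : γ s ∈ space a) :
    Chart.ip (metric a b) (γ s) (deriv γ s) E3 ^ 2 + Chart.ip (metric a b) (γ s) (N s) E3 ^ 2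
      + Chart.ip (metric a b) (γ s) (B s) E3 ^ 2 = 1 ∧
    ∃ D : ℝ, D ^ 2 = 1 ∧
      HasDerivAt (fun u => Chart.ip (metric a b) (γ u) (N u) E3)
        (-κ * Chart.ip (metric a b) (γ s) (deriv γ s) E3
          + (τ - b / 2 * D) * Chart.ip (metric a b) (γ s) (B s) E3) s ∧
      HasDerivAt (fun u => Chart.ip (metric a b) (γ u) (B u) E3)
        (-(τ - b / 2 * D) * Chart.ip (metric a b) (γ s) (N s) E3) s := by
  have key := orthonormal_triple
    ((ip_eq_frame ..).symm.trans (h.TT s hs)) ((ip_eq_frame ..).symm.trans (h.NN s hs))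
    ((ip_eq_frame ..).symm.trans (h.BB s hs)) ((ip_eq_frame ..).symm.trans (h.TN s hs))
    ((ip_eq_frame ..).symm.trans (h.TB s hs)) ((ip_eq_frame ..).symm.trans (h.NB s hs))
  have e (v : Fin 3 → ℝ) : frame a b (γ s) v 2 = Chart.ip (metric a b) (γ s) v E3 := by
    rw [ip_E3]; rfl
  obtain ⟨h1, D, hD, h2, h3⟩ := key
  simp only [e] at h1 h2 h3
  refine ⟨h1, D, hD, ?_, ?_⟩
  · refine (hasDerivAt_ip_E3 hp (h.differentiableAt_curve hI hs)
      (h.differentiableAt_N hI hs)).congr_deriv ?_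
    rw [h.frenet_N s hs, Chart.ip_add_left, Chart.ip_smul_left, Chart.ip_smul_left, h2]
    ring
  · refine (hasDerivAt_ip_E3 hp (h.differentiableAt_curve hI hs)
      (h.differentiableAt_B hI hs)).congr_deriv ?_
    rw [h.frenet_B s hs, Chart.ip_smul_left, h3]
    ring

/-- The components of the triharmonic equation of a Frenet helix along `N` and `B`. -/
theorem triharmonic_components (h : Chart.IsFrenetHelixOn (metric a b) I γ N B κ τ)
    (hI : IsOpen I) (ht : Chart.IsTriharmonicOn (metric a b) I γ) (hs : s ∈ I)
    (hp : γ s ∈ space a) :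
    (κ ^ 2 + τ ^ 2) ^ 2 - (2 * κ ^ 2 + τ ^ 2) * (4 * a - 3 * b ^ 2 / 4 - (4 * a - b ^ 2) *
        (Chart.ip (metric a b) (γ s) (deriv γ s) E3 ^ 2
          + Chart.ip (metric a b) (γ s) (N s) E3 ^ 2))
      - κ * τ * (4 * a - b ^ 2) * (Chart.ip (metric a b) (γ s) (B s) E3 *
        Chart.ip (metric a b) (γ s) (deriv γ s) E3) = 0 ∧
    (4 * a - b ^ 2) * Chart.ip (metric a b) (γ s) (N s) E3 *
      ((2 * κ ^ 2 + τ ^ 2) * Chart.ip (metric a b) (γ s) (B s) E3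
        + κ * τ * Chart.ip (metric a b) (γ s) (deriv γ s) E3) = 0 := by
  have hκ : κ ≠ 0 := (h.curvature_pos s hs).ne'
  obtain ⟨e1, e2, e3, e5⟩ := h.iterCov_eq hI hs
  have eq := ht.2 s hs
  rw [e1, e2, e3, e5] at eq
  have hTT := h.TT s hs
  have hNN := h.NN s hs
  have hBB := h.BB s hs
  have hTN := h.TN s hs
  have hTB := h.TB s hs
  have hNB := h.NB s hs
  have hNT := (ip_comm a b (γ s) _ _).trans hTN
  have hBT := (ip_comm a b (γ s) _ _).trans hTB
  have hBN := (ip_comm a b (γ s) _ _).trans hNB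
  have component (W : Fin 3 → ℝ) := congrArg (fun v => Chart.ip (metric a b) (γ s) v W) eq
  have cN := component (N s)
  have cB := component (B s)
  simp only [Chart.ip_add_left, Chart.ip_sub_left, Chart.ip_smul_left, Chart.ip_zero_left,
    ip_riemann hp, hTT, hNN, hBB, hTN, hTB, hNB, hNT, hBT, hBN] at cN cB
  constructor
  · apply mul_left_cancel₀ hκ
    linear_combination cN
  · apply mul_left_cancel₀ hκ
    linear_combination cB

theorem helix_constants_absurd {κ τ b D c t n β : ℝ} (hκ : 0 < κ) (hD : D ^ 2 = 1)
    (hn : n ≠ 0) (hunit : t ^ 2 + n ^ 2 + β ^ 2 = 1)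
    (hN : (κ ^ 2 + τ ^ 2) ^ 2 - (2 * κ ^ 2 + τ ^ 2) * (c + b ^ 2 / 4 - c * (t ^ 2 + n ^ 2))
      - κ * τ * c * (β * t) = 0)
    (hB : (2 * κ ^ 2 + τ ^ 2) * β + κ * τ * t = 0)
    (hB' : (2 * κ ^ 2 + τ ^ 2) * (-(τ - b / 2 * D) * n) + κ * τ * (κ * n) = 0) : False := by
  -- This is the differentiated B-relation divided by n.
  have h1 : (2 * κ ^ 2 + τ ^ 2) * (b / 2 * D) = τ * (κ ^ 2 + τ ^ 2) := by
    apply mul_left_cancel₀ hn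
    linear_combination hB'
  -- With t² + n² = 1 - β², all terms in c combine to a multiple of the B-relation and drop out.
  have h2 : (κ ^ 2 + τ ^ 2) ^ 2 = (2 * κ ^ 2 + τ ^ 2) * (b ^ 2 / 4) := by
    have : t ^ 2 + n ^ 2 = 1 - β ^ 2 := by linarith
    rw [this] at hN
    linear_combination hN + c * β * hB
  -- Squaring `h1` removes D; `h2` then eliminates b.
  have h3 : (κ ^ 2 + τ ^ 2) ^ 2 * (2 * κ ^ 2) = 0 := by
    have h4 := congrArg (· ^ 2) h1
    beta_reduce at h4
    linear_combination (2 * κ ^ 2 + τ ^ 2) * h2 + h4 - (2 * κ ^ 2 + τ ^ 2) ^ 2 * b ^ 2 / 4 * hD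
  have : 0 < (κ ^ 2 + τ ^ 2) ^ 2 * (2 * κ ^ 2) := by positivity
  exact this.ne' h3

theorem triharmonic_helix_N3 (hab : 4 * a ≠ b ^ 2)
    (h : Chart.IsFrenetHelixOn (metric a b) I γ N B κ τ)
    (hI : IsOpen I) (ht : Chart.IsTriharmonicOn (metric a b) I γ) (hγ : ∀ s ∈ I, γ s ∈ space a)
    (hs : s ∈ I) : Chart.ip (metric a b) (γ s) (N s) E3 = 0 := by
  by_contra hn
  obtain ⟨hunit, D, hD, hN', hB'⟩ := hasDerivAt_N3_B3 h hI hs (hγ s hs)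
  -- N₃ ≠ 0 persists near s, so the factor vanishes on a neighbourhood and can be differentiated.
  have hev : (fun u => (2 * κ ^ 2 + τ ^ 2) * Chart.ip (metric a b) (γ u) (B u) E3
      + κ * τ * Chart.ip (metric a b) (γ u) (deriv γ u) E3) =ᶠ[nhds s] fun _ => 0 := by
    filter_upwards [hN'.continuousAt.eventually_ne hn, hI.mem_nhds hs] with u hu huI
    have := (triharmonic_components h hI ht huI (hγ u huI)).2
    simpa [hu, sub_ne_zero.2 hab] using this
  have hder := ((hB'.const_mul (2 * κ ^ 2 + τ ^ 2)).add
    ((hasDerivAt_T3 h hI hs (hγ s hs)).const_mul (κ * τ))).unique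
    ((hasDerivAt_const s (0 : ℝ)).congr_of_eventuallyEq hev)
  have hN := (triharmonic_components h hI ht hs (hγ s hs)).1
  refine helix_constants_absurd (c := 4 * a - b ^ 2) (b := b) (h.curvature_pos s hs) hD hn hunit
    ?_ hev.eq_of_nhds hder
  linear_combination hN

end Helix

end BCV

/-! ### Flat Hopf cylinders and their geodesics. -/

namespace Chart

theorem christoffel_eq_zero_of_eventually_const {n : ℕ}
    {g : (Fin n → ℝ) → Matrix (Fin n) (Fin n) ℝ} {A : Matrix (Fin n) (Fin n) ℝ} {p : Fin n → ℝ}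
    (h : ∀ᶠ q in nhds p, g q = A) (k i j : Fin n) : christoffel g k i j p = 0 := by
  have hpd (l i j : Fin n) : pd l (fun q => g q i j) p = 0 := by
    have : (fun q => g q i j) =ᶠ[nhds p] fun _ => A i j := by
      filter_upwards [h] with q hq
      rw [hq]
    simp [pd, this.fderiv_eq]
  simp [christoffel, hpd]

/-- Affinely parametrized straight lines are geodesics of a locally constant metric. -/
theorem isGeodesicOn_linear {n : ℕ} {g : (Fin n → ℝ) → Matrix (Fin n) (Fin n) ℝ}
    {A : Matrix (Fin n) (Fin n) ℝ} {I : Set ℝ} (v : Fin n → ℝ)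
    (h : ∀ s ∈ I, ∀ᶠ q in nhds (s • v), g q = A) : IsGeodesicOn g I fun s => s • v := by
  refine ⟨by fun_prop, fun s hs => ?_⟩
  have hd : deriv (fun s : ℝ => s • v) = fun _ => v := by
    ext1 u
    simpa using ((hasDerivAt_id u).smul_const v).deriv
  ext k
  simp [covDeriv, hd, christoffel_eq_zero_of_eventually_const (h s hs)]

theorem ip_add_right {n : ℕ} (g : (Fin n → ℝ) → Matrix (Fin n) (Fin n) ℝ) (p v w u : Fin n → ℝ) :
    ip g p u (v + w) = ip g p u v + ip g p u w := by
  simp [ip_eq_dotProduct, Matrix.mulVec_add]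

end Chart

namespace BCV

theorem lam_add_smul_E3 (a : ℝ) (p : Fin 3 → ℝ) (t : ℝ) : lam a (p + t • E3) = lam a p := by
  simp [lam, E3]

theorem metric_add_smul_E3 (a b : ℝ) (p : Fin 3 → ℝ) (t : ℝ) :
    metric a b (p + t • E3) = metric a b p := by
  have h : omega a b (p + t • E3) = omega a b p := by
    simp only [omega, lam_add_smul_E3]
    simp [E3]
  simp only [metric, lam_add_smul_E3, h]

theorem ip_add_smul_E3 (a b : ℝ) (p v w : Fin 3 → ℝ) (t : ℝ) :
    Chart.ip (metric a b) (p + t • E3) v w = Chart.ip (metric a b) p v w := by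
  simp only [Chart.ip, metric_add_smul_E3]

theorem ip_E3_E3 (a b : ℝ) (p : Fin 3 → ℝ) : Chart.ip (metric a b) p E3 E3 = 1 := by
  rw [ip_eq_frame, frame_E3]
  simp [E3]

theorem pd_hopfCylinder {α : ℝ → Fin 3 → ℝ} {q : Fin 2 → ℝ} (h : DifferentiableAt ℝ α (q 0)) :
    Chart.pd 0 (hopfCylinder α) q = deriv α (q 0) ∧ Chart.pd 1 (hopfCylinder α) q = E3 := by
  have h0 := hasFDerivAt_apply (𝕜 := ℝ) (F' := fun _ : Fin 2 => ℝ) 0 q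
  have h1 := hasFDerivAt_apply (𝕜 := ℝ) (F' := fun _ : Fin 2 => ℝ) 1 q
  have hd : HasFDerivAt (hopfCylinder α) _ q :=
    (h.hasDerivAt.hasFDerivAt.comp q h0).add (h1.smul_const E3)
  unfold Chart.pd
  rw [hd.fderiv]
  simp

/-- Hopf cylinders are flat. -/
theorem inducedMetric_hopfCylinder {a b : ℝ} {J : Set ℝ} {α : ℝ → Fin 3 → ℝ}
    (h : IsHopfProfile a b J α) {q : Fin 2 → ℝ} (hq : q ∈ hopfDomain J) :
    Chart.inducedMetric (metric a b) (hopfCylinder α) q = 1 := by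
  obtain ⟨h0, h1⟩ := pd_hopfCylinder (q := q)
    ((h.smooth.contDiffAt (h.isOpen.mem_nhds hq)).differentiableAt (by simp))
  ext i j
  simp only [Chart.inducedMetric, Matrix.of_apply, hopfCylinder, flow, ip_add_smul_E3]
  change Chart.ip (metric a b) (α (q 0)) (Chart.pd i (hopfCylinder α) q)
    (Chart.pd j (hopfCylinder α) q) = _
  fin_cases i <;> fin_cases j
  · simpa [h0] using h.unit_speed _ hq
  · simpa [h0, h1] using h.orthogonal _ hq
  · simpa [h0, h1, ip_comm a b _ E3] using h.orthogonal _ hq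
  · simpa [h1] using ip_E3_E3 a b _

/-- In the coordinates (u, t) the curve is the line s ↦ s(μ, m), and the induced metric is the
identity near each of its points. -/
theorem isGeodesicOfSurface_hopfCylinder {a b : ℝ} {J I : Set ℝ} {α γ : ℝ → Fin 3 → ℝ}
    (h : IsHopfProfile a b J α) (μ m : ℝ) (hJ : ∀ s ∈ I, μ * s ∈ J)
    (hγ : ∀ s ∈ I, γ s = α (μ * s) + (m * s) • E3) :
    Chart.IsGeodesicOfSurface (metric a b) (hopfCylinder α) (hopfDomain J) I γ := by
  have hD : IsOpen (hopfDomain J) := h.isOpen.preimage (continuous_apply 0)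
  have hmem : ∀ s ∈ I, s • ![μ, m] ∈ hopfDomain J := fun s hs => by
    simpa [hopfDomain, mul_comm] using hJ s hs
  refine ⟨fun s => s • ![μ, m], hmem, fun s hs => ?_,
    Chart.isGeodesicOn_linear (A := 1) _ fun s hs => ?_⟩
  · simp [hopfCylinder, flow, hγ s hs, mul_comm]
  · filter_upwards [hD.mem_nhds (hmem s hs)] with q hq
    exact inducedMetric_hopfCylinder h hq

/-- A unit speed curve that makes a constant angle with the fibres, but is not a fibre, is a
geodesic of a Hopf cylinder. -/
theorem exists_hopfCylinder_of_constant_angle {a b m : ℝ} {I : Set ℝ} (hI : IsOpen I)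
    (hI' : I.OrdConnected) (hne : I.Nonempty) {γ : ℝ → Fin 3 → ℝ} (hγ : ∀ s ∈ I, γ s ∈ space a)
    (hsm : ContDiffOn ℝ ∞ γ I)
    (hT : ∀ s ∈ I, Chart.ip (metric a b) (γ s) (deriv γ s) (deriv γ s) = 1)
    (hT3 : ∀ s ∈ I, Chart.ip (metric a b) (γ s) (deriv γ s) E3 = m) (hm : m ^ 2 < 1) :
    ∃ (J : Set ℝ) (α : ℝ → Fin 3 → ℝ), IsHopfProfile a b J α ∧
      Chart.IsGeodesicOfSurface (metric a b) (hopfCylinder α) (hopfDomain J) I γ := by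
  obtain ⟨μ, hμ, hμm⟩ : ∃ μ : ℝ, 0 < μ ∧ μ ^ 2 = 1 - m ^ 2 :=
    ⟨√(1 - m ^ 2), Real.sqrt_pos.2 (by linarith), Real.sq_sqrt (by linarith)⟩
  set J : Set ℝ := (fun u => μ⁻¹ * u) ⁻¹' I with hJ
  -- The flow by -m times the parameter cancels the vertical part of γ'. The horizontal part has
  -- length μ = √(1 - m²), so rescaling by μ⁻¹ restores unit speed.
  set α : ℝ → Fin 3 → ℝ := fun u => γ (μ⁻¹ * u) + (-m * (μ⁻¹ * u)) • E3 with hα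
  have hderiv : ∀ u ∈ J, deriv α u = μ⁻¹ • (deriv γ (μ⁻¹ * u) + (-m) • E3) := fun u hu => by
    have hγ' : HasDerivAt γ (deriv γ (μ⁻¹ * u)) (μ⁻¹ * u) :=
      ((hsm.contDiffAt (hI.mem_nhds hu)).differentiableAt (by simp)).hasDerivAt
    have hlin : HasDerivAt (fun u : ℝ => μ⁻¹ * u) μ⁻¹ u := by
      simpa using (hasDerivAt_id u).const_mul μ⁻¹
    refine ((hγ'.scomp u hlin).add ((hlin.const_mul (-m)).smul_const E3)).deriv.trans ?_
    module
  have hprofile : IsHopfProfile a b J α := by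
    refine ⟨hI.preimage (by fun_prop), ⟨fun x hx y hy z hz => ?_⟩, ?_, ?_, fun u hu => ?_,
      fun u hu => ?_, fun u hu => ?_⟩
    · have := inv_pos.2 hμ
      exact hI'.out hx hy
        ⟨mul_le_mul_of_nonneg_left hz.1 this.le, mul_le_mul_of_nonneg_left hz.2 this.le⟩
    · obtain ⟨s, hs⟩ := hne
      exact ⟨μ * s, by simpa [hJ, hμ.ne'] using hs⟩
    · have hlin : ContDiff ℝ ∞ fun u : ℝ => μ⁻¹ * u := by fun_prop
      exact (hsm.comp hlin.contDiffOn fun u hu => hu).add (by fun_prop)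
    · change 0 < lam a _
      rw [lam_add_smul_E3]
      exact hγ _ hu
    · rw [hderiv u hu, hα, ip_add_smul_E3, Chart.ip_smul_left, ip_comm, Chart.ip_smul_left,
        Chart.ip_add_left, Chart.ip_add_right, Chart.ip_smul_left, Chart.ip_add_right, hT _ hu,
        ip_comm a b _ E3, ip_comm a b _ _ (_ • E3), ip_comm a b _ E3 (_ • E3),
        Chart.ip_smul_left, Chart.ip_smul_left, ip_comm a b _ E3, hT3 _ hu, ip_E3_E3]
      field_simp
      linarith
    · rw [hderiv u hu, hα, ip_add_smul_E3, Chart.ip_smul_left, Chart.ip_add_left,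
        Chart.ip_smul_left, hT3 _ hu, ip_E3_E3]
      ring
  refine ⟨J, α, hprofile, isGeodesicOfSurface_hopfCylinder hprofile μ m (fun s hs => ?_)
    fun s hs => ?_⟩
  · simpa [hJ, hμ.ne'] using hs
  · simp only [hα, inv_mul_cancel_left₀ hμ.ne']
    module

end BCV

end

/-! ### Conclusion. -/

theorem mainTheorem8 (a b : ℝ) (hab : 4 * a ≠ b ^ 2)
    (I : Set ℝ) (hI_open : IsOpen I) (hI_conn : I.OrdConnected) (hI_ne : I.Nonempty)
    (γ N B : ℝ → Fin 3 → ℝ) (hγ : ∀ s ∈ I, γ s ∈ BCV.space a)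
    (κ₀ τ₀ : ℝ) (h_helix : Chart.IsFrenetHelixOn (BCV.metric a b) I γ N B κ₀ τ₀)
    (h_tri : Chart.IsTriharmonicOn (BCV.metric a b) I γ) (hτ : τ₀ ≠ 0) :
    (∀ s ∈ I, Chart.ip (BCV.metric a b) (γ s) (N s) BCV.E3 = 0) ∧
    ∃ (J : Set ℝ) (α : ℝ → Fin 3 → ℝ), BCV.IsHopfProfile a b J α ∧
      Chart.IsGeodesicOfSurface (BCV.metric a b) (BCV.hopfCylinder α) (BCV.hopfDomain J)
        I γ := by
  have hN3 : ∀ s ∈ I, Chart.ip (BCV.metric a b) (γ s) (N s) BCV.E3 = 0 := fun s hs =>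
    BCV.triharmonic_helix_N3 hab h_helix hI_open h_tri hγ hs
  refine ⟨hN3, ?_⟩
  have hT3 (s : ℝ) (hs : s ∈ I) := BCV.hasDerivAt_T3 h_helix hI_open hs (hγ s hs)
  obtain ⟨m, hm⟩ := hI_open.exists_is_const_of_deriv_eq_zero hI_conn.isPreconnected
    (fun s hs => (hT3 s hs).differentiableAt.differentiableWithinAt)
    (fun s hs => by rw [(hT3 s hs).deriv, hN3 s hs]; simp)
  refine BCV.exists_hopfCylinder_of_constant_angle hI_open hI_conn hI_ne hγ h_helix.smooth_curve
    h_helix.TT hm ?_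
  obtain ⟨s, hs⟩ := hI_ne
  obtain ⟨hunit, D, -, hN', -⟩ := BCV.hasDerivAt_N3_B3 h_helix hI_open hs (hγ s hs)
  -- N₃ vanishes identically on I, so its derivative -κ T₃ + (τ - bD/2) B₃ is zero; this excludes a
  -- vertical tangent.
  have hzero := hN'.unique ((hasDerivAt_const s (0 : ℝ)).congr_of_eventuallyEq
    (Filter.eventuallyEq_of_mem (hI_open.mem_nhds hs) hN3))
  have hκ := h_helix.curvature_pos s hs
  rw [hm s hs] at hunit hzero
  rw [hN3 s hs] at hunit
  by_contra! hle
  have hB3 : Chart.ip (BCV.metric a b) (γ s) (B s) BCV.E3 = 0 := by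
    refine pow_eq_zero_iff two_ne_zero |>.1 (le_antisymm ?_ (sq_nonneg _))
    linarith
  rw [hB3, mul_zero, add_zero] at hzero
  have hm0 : m = 0 := (mul_eq_zero.1 hzero).resolve_left (neg_ne_zero.2 hκ.ne')
  norm_num [hm0] at hle
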